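/- Let $\mathbb F\in\{\mathbb R,\mathbb C\}$. All topological spaces are assumed Tychonoff; in particular locally convex spaces (over $\mathbb F$) are Hausdorff. For a locally convex space $E$ let $E'$ be its topological dual and $E'_\beta$ the strong dual; "operator" means continuous linear map, and "weak" refers to $\sigma(E,E')$. For $p\in[1,\infty]$, a sequence $(x_n)$ in $E$ is *weakly $p$-summable* if for every $\chi\in E'$ one has $(\chi(x_n))\in\ell_p$ (if $p<\infty$), respectively $(\chi(x_n))\in c_0$ (if $p=\infty$). The space $E$ has * the *Dunford–Pettis ($DP$) property* if each operator from $E$ into a Banach space $L$ which transforms bounded sets into relatively weakly compact sets transforms each absolutely convex weakly compact subset of $E$ into a relatively compact subset of $L$; * the *strict $DP_p$ property* if each operator from $E$ into a Banach space which transforms bounded sets into relatively weakly compact sets sends weakly $p$-summable sequences to null sequences; * the *sequential $DP$ property* if $\lim_n\chi_n(x_n)=0$ for all weakly null sequences $(x_n)$ in $E$ and $(\chi_n)$ in $E'_\beta$. The *free locally convex space* $L(X)$ over a Tychonoff space $X$ is the vector space with Hamel basis $X$, endowed with the finest locally convex vector topology for which the inclusion $X\to L(X)$ is continuous; equivalently,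 every continuous map from $X$ to a locally convex space extends uniquely to an operator on $L(X)$. **Proposition 4.13.** Let $p\in[1,\infty]$. (i) For every Tychonoff space $X$, the space $L(X)$ has the $DP$ property and the strict $DP_p$ property. (ii) Every locally convex space is (topologically isomorphic to) a quotient $F/N$ of a locally convex space $F$ with the $DP$ property and the strict $DP_p$ property by a closed subspace $N$. Consequently, quotients need not inherit these properties: there are a locally convex space $F$ with the $DP$ property and the strict $DP_p$ property and a closed subspace $N\subseteq F$ such that $F/N$ does not have the $DP$ property and, if $p>1$, does not have the strict $DP_p$ property. (iii) If $X$ is a non-discrete metrizable space, then $L(X)$ does not have the sequential $DP$ property. -/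

import Mathlib

universe k u v w

open Filter Topology
open scoped ENNReal ComplexOrder

/- Conventions.  The scalar field `𝕜` is `ℝ` or `ℂ` (`RCLike 𝕜`).  With `ComplexOrder` open, the
nonnegative elements of `𝕜` are exactly the nonnegative reals, so `Convex 𝕜 s` is convexity in the
usual (real) sense and `LocallyConvexSpace 𝕜 E` is local convexity in the usual sense.
`StrongDual 𝕜 E` carries the topology of uniform convergence on bounded sets, i.e. it is the
strong dual of `E`; `WeakSpace 𝕜 E` is `E` with its weak topology. -/

/-- Over `𝕜 = ℝ` or `ℂ`, local convexity is local convexity of the underlying real space. -/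
theorem locallyConvexSpace_iff_real {𝕜 : Type k} [RCLike 𝕜] {E : Type u} [AddCommGroup E]
    [Module 𝕜 E] [Module ℝ E] [IsScalarTower ℝ 𝕜 E] [TopologicalSpace E] :
    LocallyConvexSpace 𝕜 E ↔ LocallyConvexSpace ℝ E := by
  simp only [locallyConvexSpace_iff, convex_RCLike_iff_convex_real]

section DunfordPettis

variable (𝕜 : Type k) [RCLike 𝕜]

/-- The operator `T` from a topological vector space to a normed space transforms bounded sets
into relatively weakly compact sets. -/
def MapsBoundedToRelWeaklyCompact {𝕜 : Type k} [RCLike 𝕜]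
    {E : Type u} [AddCommGroup E] [Module 𝕜 E] [TopologicalSpace E]
    {L : Type v} [NormedAddCommGroup L] [NormedSpace 𝕜 L] (T : E →L[𝕜] L) : Prop :=
  ∀ B : Set E, Bornology.IsVonNBounded 𝕜 B →
    IsCompact (closure (toWeakSpace 𝕜 L '' (T '' B)))

/-- A sequence in `E` is weakly `p`-summable if its image under every continuous functional lies
in `ℓ_p` (for `p < ∞`), respectively in `c₀` (for `p = ∞`). -/
def IsWeaklyPSummable (p : ℝ≥0∞) {E : Type u} [AddCommGroup E] [Module 𝕜 E] [TopologicalSpace E]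
    (x : ℕ → E) : Prop :=
  ∀ χ : StrongDual 𝕜 E,
    (p ≠ ∞ → Memℓp (fun n => χ (x n)) p) ∧ (p = ∞ → Tendsto (fun n => χ (x n)) atTop (𝓝 0))

/-- A sequence in `E` is weakly null. -/
def IsWeaklyNull {E : Type u} [AddCommGroup E] [Module 𝕜 E] [TopologicalSpace E]
    (x : ℕ → E) : Prop :=
  ∀ χ : StrongDual 𝕜 E, Tendsto (fun n => χ (x n)) atTop (𝓝 0)

/-- An operator is `p`-convergent if it sends weakly `p`-summable sequences to null sequences. -/
def IsPConvergent {𝕜 : Type k} [RCLike 𝕜] (p : ℝ≥0∞)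
    {E : Type u} [AddCommGroup E] [Module 𝕜 E] [TopologicalSpace E]
    {L : Type v} [AddCommGroup L] [Module 𝕜 L] [TopologicalSpace L] (T : E →L[𝕜] L) : Prop :=
  ∀ x : ℕ → E, IsWeaklyPSummable 𝕜 p x → Tendsto (fun n => T (x n)) atTop (𝓝 0)

variable (E : Type u) [AddCommGroup E] [Module 𝕜 E] [TopologicalSpace E]

/-- The Dunford--Pettis property: each operator from `E` to a Banach space which transforms bounded
sets into relatively weakly compact sets transforms each absolutely convex weakly compact set into
a relatively compact set.

The Banach spaces range over the universe of `E`. This is no restriction: an operator `T` may be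
replaced by its corestriction to the closure of its range, every element of which is the limit of
a sequence in `T '' E`, so that this closure has a copy in the universe of `E`. -/
def HasDP : Prop :=
  ∀ (L : Type u) [NormedAddCommGroup L] [NormedSpace 𝕜 L] [CompleteSpace L] (T : E →L[𝕜] L),
    MapsBoundedToRelWeaklyCompact T →
      ∀ K : Set E, AbsConvex 𝕜 K → IsCompact (toWeakSpace 𝕜 E '' K) → IsCompact (closure (T '' K))

/-- The strict Dunford--Pettis property of order `p`: each operator from `E` to a Banach space
which transforms bounded sets into relatively weakly compact sets is `p`-convergent.  (As for
`HasDP`, the universe of the Banach spaces is no restriction.) -/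
def HasStrictDP (p : ℝ≥0∞) : Prop :=
  ∀ (L : Type u) [NormedAddCommGroup L] [NormedSpace 𝕜 L] [CompleteSpace L] (T : E →L[𝕜] L),
    MapsBoundedToRelWeaklyCompact T → IsPConvergent p T

/-- The sequential Dunford--Pettis property: `⟨χ n, x n⟩ → 0` for all weakly null sequences `x`
in `E` and `χ` in the strong dual of `E`. -/
def HasSequentialDP : Prop :=
  ∀ (x : ℕ → E) (χ : ℕ → StrongDual 𝕜 E), IsWeaklyNull 𝕜 x → IsWeaklyNull 𝕜 χ →
    Tendsto (fun n => χ n (x n)) atTop (𝓝 0)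

end DunfordPettis

section FreeLCS

variable (𝕜 : Type k) [RCLike 𝕜] (X : Type u)

/-- The vector space underlying the free locally convex space `L(X)`: it has `X` as a Hamel
basis. -/
def FreeLCS : Type (max u k) := X →₀ 𝕜

noncomputable instance FreeLCS.instAddCommGroup : AddCommGroup (FreeLCS 𝕜 X) :=
  inferInstanceAs (AddCommGroup (X →₀ 𝕜))

noncomputable instance FreeLCS.instModule : Module 𝕜 (FreeLCS 𝕜 X) :=
  inferInstanceAs (Module 𝕜 (X →₀ 𝕜))

/-- The canonical map `i : X → L(X)`. -/
noncomputable def FreeLCS.ι (x : X) : FreeLCS 𝕜 X := Finsupp.single x (1 : 𝕜)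

variable [TopologicalSpace X]

/-- The locally convex vector topologies on the vector space with basis `X` for which the canonical
map is continuous. -/
def FreeLCS.admissibleTopologies : Set (TopologicalSpace (FreeLCS 𝕜 X)) :=
  {t | @IsTopologicalAddGroup (FreeLCS 𝕜 X) t _ ∧ @ContinuousSMul 𝕜 (FreeLCS 𝕜 X) _ _ t ∧
    @LocallyConvexSpace 𝕜 (FreeLCS 𝕜 X) _ _ _ _ t ∧
    @Continuous X (FreeLCS 𝕜 X) _ t (FreeLCS.ι 𝕜 X)}

/-- The topology of `L(X)` is the finest locally convex vector topology for which the canonical map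
is continuous. -/
instance FreeLCS.instTopologicalSpace : TopologicalSpace (FreeLCS 𝕜 X) :=
  sInf (FreeLCS.admissibleTopologies 𝕜 X)

instance FreeLCS.instIsTopologicalAddGroup : IsTopologicalAddGroup (FreeLCS 𝕜 X) :=
  topologicalAddGroup_sInf fun _ ht => ht.1

instance FreeLCS.instContinuousSMul : ContinuousSMul 𝕜 (FreeLCS 𝕜 X) :=
  continuousSMul_sInf fun _ ht => ht.2.1

instance FreeLCS.instLocallyConvexSpace : LocallyConvexSpace 𝕜 (FreeLCS 𝕜 X) :=
  LocallyConvexSpace.sInf fun _ ht => ht.2.2.1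

theorem FreeLCS.continuous_ι : Continuous (FreeLCS.ι 𝕜 X) :=
  continuous_sInf_rng.2 fun _ ht => ht.2.2.2

/-- The universal property of `L(X)`: every continuous map from `X` to a locally convex space
extends uniquely to a continuous linear map on `L(X)`. -/
theorem FreeLCS.existsUnique_lift {E : Type w} [AddCommGroup E] [Module 𝕜 E]
    [tE : TopologicalSpace E] [IsTopologicalAddGroup E] [ContinuousSMul 𝕜 E]
    [LocallyConvexSpace 𝕜 E] (f : X → E) (hf : Continuous f) :
    ∃! T : FreeLCS 𝕜 X →L[𝕜] E, ∀ x, T (FreeLCS.ι 𝕜 X x) = f x := by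
  let T₀ : FreeLCS 𝕜 X →ₗ[𝕜] E := Finsupp.linearCombination 𝕜 f
  have hT₀ : ∀ x, T₀ (FreeLCS.ι 𝕜 X x) = f x := fun x =>
    (Finsupp.linearCombination_single 𝕜 (1 : 𝕜) x).trans (one_smul 𝕜 (f x))
  have hmem : TopologicalSpace.induced T₀ tE ∈ FreeLCS.admissibleTopologies 𝕜 X := by
    refine ⟨topologicalAddGroup_induced T₀, continuousSMul_induced T₀,
      LocallyConvexSpace.induced T₀, continuous_induced_rng.2 ?_⟩
    have : (T₀ ∘ FreeLCS.ι 𝕜 X) = f := funext hT₀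
    rw [this]
    exact hf
  have hcont : Continuous T₀ := continuous_iff_le_induced.2 (sInf_le hmem)
  refine ⟨⟨T₀, hcont⟩, hT₀, fun S hS => ?_⟩
  ext z
  have : (S : FreeLCS 𝕜 X →ₗ[𝕜] E) = T₀ :=
    Finsupp.lhom_ext' (M := 𝕜) fun x => LinearMap.ext_ring ((hS x).trans (hT₀ x).symm)
  exact LinearMap.congr_fun this z

/-- Over a Tychonoff space, `L(X)` is Hausdorff. -/
instance FreeLCS.instT2Space [T35Space X] : T2Space (FreeLCS 𝕜 X) := by
  classical
  refine IsTopologicalAddGroup.t2Space_of_zero_sep (G := FreeLCS 𝕜 X) fun z hz => ?_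
  change X →₀ 𝕜 at z
  obtain ⟨x, hx⟩ : ∃ x, z x ≠ 0 := Finsupp.ne_iff.1 (show z ≠ (0 : X →₀ 𝕜) from hz)
  have hclosed : IsClosed ((z.support.erase x : Finset X) : Set X) :=
    (Finset.finite_toSet _).isClosed
  obtain ⟨g, hg, hgx, hg1⟩ := CompletelyRegularSpace.completely_regular x _ hclosed
    (by simp)
  have : LocallyConvexSpace 𝕜 𝕜 := locallyConvexSpace_iff_real.2 inferInstance
  obtain ⟨T, hT, -⟩ := FreeLCS.existsUnique_lift 𝕜 X (fun y => ((1 - (g y : ℝ) : ℝ) : 𝕜))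
    (RCLike.continuous_ofReal.comp (continuous_const.sub (continuous_subtype_val.comp hg)))
  have hTz : T z = z x := by
    have h1 : T z = Finsupp.sum z fun y a => a * ((1 - (g y : ℝ) : ℝ) : 𝕜) := by
      conv_lhs => rw [← Finsupp.sum_single z]
      have := map_finsuppSum (T : FreeLCS 𝕜 X →ₗ[𝕜] 𝕜) z (fun y a => Finsupp.single y a)
      refine this.trans (Finset.sum_congr rfl fun y _ => ?_)
      have h2 : (Finsupp.single y (z y) : X →₀ 𝕜) = (z y) • (FreeLCS.ι 𝕜 X y : X →₀ 𝕜) := by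
        exact (Finsupp.smul_single_one y (z y)).symm
      change T (Finsupp.single y (z y) : X →₀ 𝕜) = _
      rw [h2]
      exact (map_smul T (z y) (FreeLCS.ι 𝕜 X y)).trans (by rw [hT y, smul_eq_mul])
    rw [h1, Finsupp.sum, Finset.sum_eq_single x]
    · simp [hgx]
    · intro y hy hyx
      have : g y = 1 := hg1 (by simp [hyx] at hy ⊢; exact hy)
      simp [this]
    · intro h
      simp [Finsupp.notMem_support_iff.1 h]
  refine ⟨T ⁻¹' {z x}ᶜ, T.continuous.continuousAt (isOpen_compl_singleton.mem_nhds ?_),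
    fun h => h hTz⟩
  rw [map_zero]
  exact fun h => hx h.symm

end FreeLCS

/-!
Why the statement holds. The dual of `L(X)` is `C(X)`, and the elements of `L(X)` are finitely
supported measures on `X`. The main point is that a weakly bounded set `B` of such measures is very
small. The uniform boundedness principle on the Banach space of bounded continuous functions, applied
to the functionals `d ↦ ∫ W d dμ` with `μ ∈ B`, bounds the variations `∫ W d|μ|` for every continuous
weight `W` (`FreeLCS.exists_weighted_variation_le`). Since `W` may grow arbitrarily fast along a
uniformly separated sequence, a continuous map from `X` to a metric space has totally bounded values
on the union of the supports of `B` (`FreeLCS.totallyBounded_image_support`). An operator `T` from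
`L(X)` to a Banach space then maps `B` into a multiple of the absolutely convex hull of a totally
bounded set, so `T` maps all weakly bounded sets to relatively compact ones
(`FreeLCS.isCompact_closure_image`). Both the `DP` property and the strict `DP_p` property of `L(X)`
follow, the latter because weakly null sequences in a compact set are null.

A locally convex space `E` is a quotient of `L(E)`: the operator `L(E) → E` extending the identity
has the continuous right inverse `E → L(E)` (`FreeLCS.exists_quotient_equiv`). For a quotient without
the two properties take `E = ℓ_q` with `1 < q < ∞`. Its balls are weakly compact
(`lp.isCompact_toWeakSpace_closedBall`), so the identity of `ℓ_q` is a test operator for both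
properties, and it does not send the unit vectors to a null sequence, although they are weakly
`r`-summable for the exponent `r` conjugate to `q` (`lp.memℓp_apply_single`).

If `x n → a` in a metric space, fast and without reaching `a`, there are bumps `g n` with disjoint
supports, `g n (x n) = 1` and `g n a = 0`. Bounded sets of `L(X)` have bounded variation, so the
combinations of the `g n` with coefficients in the unit disc are bounded in the strong dual, which
makes `g n` weakly null there (`FreeLCS.isWeaklyNull_integral`). The differences `x n - a` are weakly
null in `L(X)`, and `g n` takes the value `1` on them.
-/

/-! ### Weakly bounded sets -/

/-- A subset of `E` is weakly bounded if every continuous functional is bounded on it. -/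
def IsWeaklyBounded (𝕜 : Type k) [RCLike 𝕜] {E : Type u} [AddCommGroup E] [Module 𝕜 E]
    [TopologicalSpace E] (B : Set E) : Prop :=
  ∀ χ : StrongDual 𝕜 E, ∃ C : ℝ, ∀ z ∈ B, ‖χ z‖ ≤ C

section WeaklyBounded

variable {𝕜 : Type k} [RCLike 𝕜] {E : Type u} [AddCommGroup E] [Module 𝕜 E] [TopologicalSpace E]

theorem Bornology.IsVonNBounded.isWeaklyBounded {B : Set E} (hB : Bornology.IsVonNBounded 𝕜 B) :
    IsWeaklyBounded 𝕜 B := by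
  intro χ
  obtain ⟨C, hC⟩ := isBounded_iff_forall_norm_le.1
    ((NormedSpace.isVonNBounded_iff 𝕜).1 (hB.image χ))
  exact ⟨C, fun z hz => hC _ ⟨z, hz, rfl⟩⟩

theorem continuous_weakSpace_eval (χ : StrongDual 𝕜 E) :
    Continuous fun z : WeakSpace 𝕜 E => χ ((toWeakSpace 𝕜 E).symm z) :=
  WeakBilin.eval_continuous (topDualPairing 𝕜 E).flip χ

theorem IsCompact.isWeaklyBounded {K : Set E} (hK : IsCompact (toWeakSpace 𝕜 E '' K)) :
    IsWeaklyBounded 𝕜 K := by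
  intro χ
  obtain ⟨C, hC⟩ := isBounded_iff_forall_norm_le.1
    (hK.image (continuous_weakSpace_eval χ)).isBounded
  exact ⟨C, fun z hz => hC _ ⟨_, ⟨z, hz, rfl⟩, by simp⟩⟩

theorem IsWeaklyNull.isWeaklyBounded_range {x : ℕ → E} (hx : IsWeaklyNull 𝕜 x) :
    IsWeaklyBounded 𝕜 (Set.range x) := by
  intro χ
  obtain ⟨C, hC⟩ := isBounded_iff_forall_norm_le.1
    (Metric.isBounded_range_of_tendsto _ (hx χ))
  refine ⟨C, ?_⟩
  rintro _ ⟨n, rfl⟩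
  exact hC _ ⟨n, rfl⟩

theorem IsWeaklyPSummable.isWeaklyNull {p : ℝ≥0∞} (hp : 1 ≤ p) {x : ℕ → E}
    (hx : IsWeaklyPSummable 𝕜 p x) : IsWeaklyNull 𝕜 x := by
  intro χ
  by_cases h : p = ∞
  · exact (hx χ).2 h
  have hp0 : 0 < p.toReal := ENNReal.toReal_pos (by positivity) h
  have h1 := (((hx χ).1 h).summable hp0).tendsto_atTop_zero
  have h2 := h1.rpow_const (p := 1 / p.toReal) (Or.inr (by positivity))
  rw [Real.zero_rpow (by positivity)] at h2
  refine tendsto_zero_iff_norm_tendsto_zero.2 (h2.congr fun n => ?_)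
  rw [← Real.rpow_mul (norm_nonneg _), mul_one_div_cancel hp0.ne', Real.rpow_one]

theorem IsWeaklyNull.map {L : Type v} [AddCommGroup L] [Module 𝕜 L] [TopologicalSpace L]
    {x : ℕ → E} (hx : IsWeaklyNull 𝕜 x) (T : E →L[𝕜] L) : IsWeaklyNull 𝕜 fun n => T (x n) :=
  fun χ => hx (χ.comp T)

/-- The only possible cluster point of a weakly null sequence is `0`, so inside a compact set it
converges to `0` in norm. -/
theorem IsWeaklyNull.tendsto_zero {L : Type v} [NormedAddCommGroup L] [NormedSpace 𝕜 L]
    {y : ℕ → L} (hy : IsWeaklyNull 𝕜 y) {K : Set L} (hK : IsCompact K) (hyK : ∀ n, y n ∈ K) :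
    Tendsto y atTop (𝓝 0) := by
  refine tendsto_of_subseq_tendsto fun ns hns => ?_
  obtain ⟨a, -, φ, hφ, ha⟩ := hK.tendsto_subseq fun n => hyK (ns n)
  refine ⟨φ, ?_⟩
  have ha0 : a = 0 := by
    refine (SeparatingDual.eq_iff_forall_dual_eq (R := 𝕜)).2 fun χ => ?_
    rw [map_zero]
    exact tendsto_nhds_unique ((χ.continuous.tendsto a).comp ha)
      ((hy χ).comp (hns.comp hφ.tendsto_atTop))
  exact ha0 ▸ ha

end WeaklyBounded

/-! ### Functionals and operators on the free locally convex space -/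

section FreeLCS

/-- An element of `L(X)` as the finitely supported function of its coefficients. -/
noncomputable def FreeLCS.coeff (𝕜 : Type k) [RCLike 𝕜] (X : Type u) :
    FreeLCS 𝕜 X ≃ₗ[𝕜] (X →₀ 𝕜) :=
  LinearEquiv.refl 𝕜 _

variable {𝕜 : Type k} [RCLike 𝕜] {X : Type u}

theorem FreeLCS.linearMap_apply {E : Type w} [AddCommGroup E] [Module 𝕜 E]
    (T : FreeLCS 𝕜 X →ₗ[𝕜] E) (z : FreeLCS 𝕜 X) :
    T z = ∑ x ∈ (coeff 𝕜 X z).support, coeff 𝕜 X z x • T (ι 𝕜 X x) := by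
  obtain ⟨μ, rfl⟩ := (coeff 𝕜 X).symm.surjective z
  have h : T ∘ₗ (coeff 𝕜 X).symm.toLinearMap =
      Finsupp.linearCombination 𝕜 fun x => T (ι 𝕜 X x) := by
    refine Finsupp.lhom_ext' fun x => LinearMap.ext_ring ?_
    simp only [LinearMap.comp_apply, Finsupp.lsingle_apply, Finsupp.linearCombination_single,
      one_smul]
    rfl
  have := LinearMap.congr_fun h μ
  rw [Finsupp.linearCombination_apply, Finsupp.sum] at this
  simpa using this

variable [TopologicalSpace X]

/-- Integration of a continuous function against the finitely supported measures in `L(X)`: the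
functional on `L(X)` extending the function. -/
noncomputable def FreeLCS.integral (g : C(X, 𝕜)) : StrongDual 𝕜 (FreeLCS 𝕜 X) :=
  have : LocallyConvexSpace 𝕜 𝕜 := locallyConvexSpace_iff_real.2 inferInstance
  (existsUnique_lift 𝕜 X g g.continuous).choose

theorem FreeLCS.integral_ι (g : C(X, 𝕜)) (x : X) : integral g (ι 𝕜 X x) = g x :=
  have : LocallyConvexSpace 𝕜 𝕜 := locallyConvexSpace_iff_real.2 inferInstance
  (existsUnique_lift 𝕜 X g g.continuous).choose_spec.1 x

theorem FreeLCS.integral_apply (g : C(X, 𝕜)) (z : FreeLCS 𝕜 X) :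
    integral g z = ∑ x ∈ (coeff 𝕜 X z).support, coeff 𝕜 X z x * g x := by
  refine (linearMap_apply (integral g : FreeLCS 𝕜 X →ₗ[𝕜] 𝕜) z).trans ?_
  simp [integral_ι]

/-! ### Weighted variation of weakly bounded sets -/

/-- On a finite subset of a Tychonoff space, every function with values in the unit disc is the
restriction of a continuous function with values in the unit disc: Tietze's theorem in the
Stone–Čech compactification. -/
theorem exists_boundedContinuous_extension [T35Space X] (s : Finset X) (σ : X → 𝕜)
    (hσ : ∀ x ∈ s, ‖σ x‖ ≤ 1) :
    ∃ d : BoundedContinuousFunction X 𝕜, ‖d‖ ≤ 1 ∧ ∀ x ∈ s, d x = σ x := by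
  have he : IsClosedEmbedding fun x : s => stoneCechUnit (x : X) :=
    (continuous_stoneCechUnit.comp continuous_subtype_val).isClosedEmbedding
      (injective_stoneCechUnit_of_t35Space.comp Subtype.val_injective)
  have := Metric.instTietzeExtensionClosedBall.{u} 𝕜 (0 : 𝕜) one_pos
  obtain ⟨g, hg, hgs⟩ := ContinuousMap.exists_extension_forall_mem he
    (⟨fun x => σ x, continuous_of_discreteTopology⟩ : C(s, 𝕜))
    (t := Metric.closedBall (0 : 𝕜) 1) (fun x => by simpa using hσ x x.2)
  refine ⟨BoundedContinuousFunction.ofNormedAddCommGroup (fun x => g (stoneCechUnit x))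
    (g.continuous.comp continuous_stoneCechUnit) 1 fun x => by simpa using hg (stoneCechUnit x),
    BoundedContinuousFunction.norm_ofNormedAddCommGroup_le _ zero_le_one _, fun x hx => ?_⟩
  exact DFunLike.congr_fun hgs ⟨x, hx⟩

/-- By the uniform boundedness principle on the bounded continuous functions, a weakly bounded
subset of `L(X)` has bounded variation with respect to every continuous weight, however fast the
weight grows. -/
theorem FreeLCS.exists_weighted_variation_le [T35Space X] {B : Set (FreeLCS 𝕜 X)}
    (hB : IsWeaklyBounded 𝕜 B) (W : C(X, ℝ)) :
    ∃ C : ℝ, ∀ z ∈ B, ∑ x ∈ (coeff 𝕜 X z).support, ‖coeff 𝕜 X z x‖ * W x ≤ C := by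
  let Λ : B → BoundedContinuousFunction X 𝕜 →L[𝕜] 𝕜 := fun z =>
    ∑ x ∈ (coeff 𝕜 X z).support, (coeff 𝕜 X z x * (W x : 𝕜)) •
      BoundedContinuousFunction.evalCLM 𝕜 x
  have hΛ : ∀ z d, Λ z d = ∑ x ∈ (coeff 𝕜 X z).support, coeff 𝕜 X z x * ((W x : 𝕜) * d x) := by
    intro z d
    simp [Λ, mul_assoc]
  obtain ⟨C, hC⟩ := banach_steinhaus (g := Λ) fun d => by
    obtain ⟨C, hC⟩ := hB (integral ⟨fun x => (W x : 𝕜) * d x, by fun_prop⟩)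
    refine ⟨C, fun z => ?_⟩
    rw [hΛ]
    simpa [integral_apply] using hC z z.2
  refine ⟨C, fun z hz => ?_⟩
  -- `σ` is the phase turning each coefficient into its absolute value
  obtain ⟨d, hd, hds⟩ := exists_boundedContinuous_extension (coeff 𝕜 X z).support
    (fun x => (‖coeff 𝕜 X z x‖ : 𝕜) / coeff 𝕜 X z x) fun x hx => by
      rw [norm_div, RCLike.norm_ofReal, abs_norm]
      exact div_self_le_one _
  have h1 : Λ ⟨z, hz⟩ d =
      ((∑ x ∈ (coeff 𝕜 X z).support, ‖coeff 𝕜 X z x‖ * W x : ℝ) : 𝕜) := by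
    rw [hΛ]
    push_cast
    refine Finset.sum_congr rfl fun x hx => ?_
    have := Finsupp.mem_support_iff.1 hx
    rw [hds x hx]
    field_simp
  calc ∑ x ∈ (coeff 𝕜 X z).support, ‖coeff 𝕜 X z x‖ * W x
      ≤ ‖Λ ⟨z, hz⟩ d‖ := by
        rw [h1, RCLike.norm_ofReal]
        exact le_abs_self _
    _ ≤ ‖Λ ⟨z, hz⟩‖ * ‖d‖ := (Λ ⟨z, hz⟩).le_opNorm d
    _ ≤ ‖Λ ⟨z, hz⟩‖ * 1 := by gcongr
    _ ≤ C := by simpa using hC ⟨z, hz⟩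

/-- A continuous map to a metric space has totally bounded values on the union of the supports of a
weakly bounded set. Otherwise the values contain a uniformly separated sequence, and there is a
weight growing along it so fast that the weighted variations are unbounded. -/
theorem FreeLCS.totallyBounded_image_support [T35Space X] {B : Set (FreeLCS 𝕜 X)}
    (hB : IsWeaklyBounded 𝕜 B) {M : Type v} [MetricSpace M] (f : C(X, M)) :
    TotallyBounded (f '' {x | ∃ z ∈ B, coeff 𝕜 X z x ≠ 0}) := by
  by_contra h
  rw [Metric.totallyBounded_iff] at h
  push Not at h
  obtain ⟨ε, hε, hcov⟩ := h
  obtain ⟨x, hx, hsep⟩ := exists_seq_of_forall_finset_exists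
    (fun x => ∃ z ∈ B, coeff 𝕜 X z x ≠ 0) (fun x y => ε ≤ dist (f x) (f y)) fun s _ => by
      obtain ⟨_, ⟨y, hy, rfl⟩, hys⟩ := Set.not_subset.1 (hcov (f '' s) (s.finite_toSet.image f))
      refine ⟨y, hy, fun a ha => ?_⟩
      by_contra hlt
      exact hys (Set.mem_iUnion₂.2 ⟨f a, ⟨a, ha, rfl⟩, by
        rw [Metric.mem_ball, dist_comm]; exact not_le.1 hlt⟩)
  choose z hzB hz using hx
  have he : IsClosedEmbedding fun n => f (x n) :=
    Metric.isClosedEmbedding_of_pairwise_le_dist hε fun m n hmn => by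
      rcases lt_or_gt_of_ne hmn with h | h
      · exact hsep m n h
      · rw [dist_comm]; exact hsep n m h
  obtain ⟨W, hW⟩ := ContinuousMap.exists_extension' he
    (⟨fun n => n / ‖coeff 𝕜 X (z n) (x n)‖, continuous_of_discreteTopology⟩ : C(ℕ, ℝ))
  obtain ⟨C, hC⟩ := exists_weighted_variation_le hB
    (⟨fun y => |W (f y)|, by fun_prop⟩ : C(X, ℝ))
  obtain ⟨n, hn⟩ := exists_nat_gt C
  have hWn : W (f (x n)) = n / ‖coeff 𝕜 X (z n) (x n)‖ := congrFun hW n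
  have h1 := Finset.single_le_sum (f := fun y => ‖coeff 𝕜 X (z n) y‖ * |W (f y)|)
    (fun y _ => by positivity) (Finsupp.mem_support_iff.2 (hz n))
  have h2 : ‖coeff 𝕜 X (z n) (x n)‖ * |W (f (x n))| = n := by
    have := norm_pos_iff.2 (hz n)
    rw [hWn, abs_of_nonneg (by positivity)]
    field_simp
  have h3 := hC (z n) (hzB n)
  simp only [ContinuousMap.coe_mk] at h3
  simp only [h2] at h1
  linarith

/-! ### Operators from the free locally convex space to Banach spaces -/

/-- Every operator from `L(X)` to a Banach space maps weakly bounded sets to relatively compact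
ones: the values lie in a multiple of the absolutely convex hull of a totally bounded set. -/
theorem FreeLCS.isCompact_closure_image [T35Space X] {B : Set (FreeLCS 𝕜 X)}
    (hB : IsWeaklyBounded 𝕜 B) {L : Type v} [NormedAddCommGroup L] [NormedSpace 𝕜 L]
    [CompleteSpace L] (T : FreeLCS 𝕜 X →L[𝕜] L) : IsCompact (closure (T '' B)) := by
  let : NormedSpace ℝ L := NormedSpace.restrictScalars ℝ 𝕜 L
  have : IsScalarTower ℝ 𝕜 L := IsScalarTower.of_algebraMap_smul fun r x => rfl
  refine TotallyBounded.isCompact_of_isClosed ?_ isClosed_closure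
  refine TotallyBounded.closure ?_
  obtain ⟨C, hC⟩ := exists_weighted_variation_le hB 1
  set S := T ∘ ι 𝕜 X '' {x | ∃ z ∈ B, coeff 𝕜 X z x ≠ 0}
  have hS : TotallyBounded S :=
    totallyBounded_image_support hB ⟨_, T.continuous.comp (continuous_ι 𝕜 X)⟩
  set S' : Set L := 
    insert 0 ((fun q : 𝕜 × L => q.1 • q.2) '' Metric.closedBall 0 C ×ˢ closure S)
  have hS' : TotallyBounded S' := by
    refine IsCompact.totallyBounded (IsCompact.insert ?_ 0)
    exact ((isCompact_closedBall (0 : 𝕜) C).prod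
      (hS.closure.isCompact_of_isClosed isClosed_closure)).image continuous_smul
  refine TotallyBounded.subset ?_ (totallyBounded_convexHull.2 hS')
  rintro _ ⟨z, hz, rfl⟩
  have hTz := linearMap_apply (T : FreeLCS 𝕜 X →ₗ[𝕜] L) z
  simp only [ContinuousLinearMap.coe_coe] at hTz
  set m := ∑ x ∈ (coeff 𝕜 X z).support, ‖coeff 𝕜 X z x‖ with hm
  have hmC : m ≤ C := by simpa using hC z hz
  rcases (Finset.sum_nonneg fun x _ => norm_nonneg (coeff 𝕜 X z x) : 0 ≤ m).eq_or_lt with h0 | h0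
  · have : ∀ x ∈ (coeff 𝕜 X z).support, ‖coeff 𝕜 X z x‖ = 0 :=
      (Finset.sum_eq_zero_iff_of_nonneg fun x _ => norm_nonneg _).1 h0.symm
    rw [hTz, Finset.sum_eq_zero fun x hx => by rw [norm_eq_zero.1 (this x hx), zero_smul]]
    exact subset_convexHull ℝ _ (Set.mem_insert _ _)
  -- `T z` is the convex combination of the `(m a / ‖a‖) • T x` with weights `‖a‖ / m`
  have hcomb : T z = ∑ x ∈ (coeff 𝕜 X z).support, (‖coeff 𝕜 X z x‖ / m) •
      ((((m / ‖coeff 𝕜 X z x‖ : ℝ) : 𝕜) * coeff 𝕜 X z x) • T (ι 𝕜 X x)) := by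
    rw [hTz]
    refine Finset.sum_congr rfl fun x hx => ?_
    have hx0 := norm_ne_zero_iff.2 (Finsupp.mem_support_iff.1 hx)
    rw [mul_smul, ← RCLike.real_smul_eq_coe_smul (K := 𝕜), smul_smul,
      div_mul_div_cancel₀ h0.ne', div_self hx0, one_smul]
  rw [hcomb]
  refine (convex_convexHull ℝ S').sum_mem (fun x _ => by positivity) ?_ fun x hx => ?_
  · rw [← Finset.sum_div, div_self h0.ne']
  · refine subset_convexHull ℝ _ (Set.mem_insert_of_mem _ ?_)
    have hx0 := norm_ne_zero_iff.2 (Finsupp.mem_support_iff.1 hx)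
    refine ⟨(_, _), ⟨?_, subset_closure ⟨x, ⟨z, hz, Finsupp.mem_support_iff.1 hx⟩, rfl⟩⟩, rfl⟩
    rw [mem_closedBall_zero_iff, norm_mul, RCLike.norm_ofReal, abs_of_nonneg (by positivity),
      div_mul_cancel₀ _ hx0]
    exact hmC

theorem FreeLCS.hasDP [T35Space X] : HasDP 𝕜 (FreeLCS 𝕜 X) :=
  fun _ _ _ _ T _ _ _ hK => isCompact_closure_image hK.isWeaklyBounded T

theorem FreeLCS.hasStrictDP [T35Space X] {p : ℝ≥0∞} (hp : 1 ≤ p) :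
    HasStrictDP 𝕜 (FreeLCS 𝕜 X) p := by
  intro L _ _ _ T _ x hx
  have hx' := hx.isWeaklyNull hp
  exact (hx'.map T).tendsto_zero (isCompact_closure_image hx'.isWeaklyBounded_range T)
    fun n => subset_closure ⟨_, ⟨n, rfl⟩, rfl⟩

end FreeLCS

/-! ### Locally convex spaces as quotients of free ones -/

/-- The operator `L(E) → E` extending the identity has the continuous right inverse `E → L(E)`, so
it is a quotient map. -/
theorem FreeLCS.exists_quotient_equiv (𝕜 : Type k) [RCLike 𝕜] (E : Type w) [AddCommGroup E]
    [Module 𝕜 E] [TopologicalSpace E] [IsTopologicalAddGroup E] [ContinuousSMul 𝕜 E]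
    [LocallyConvexSpace 𝕜 E] [T2Space E] :
    ∃ N : Submodule 𝕜 (FreeLCS 𝕜 E), IsClosed (N : Set (FreeLCS 𝕜 E)) ∧
      Nonempty ((FreeLCS 𝕜 E ⧸ N) ≃L[𝕜] E) := by
  obtain ⟨T, hT, -⟩ := existsUnique_lift 𝕜 E (id : E → E) continuous_id
  have hsurj : Function.Surjective (T : FreeLCS 𝕜 E →ₗ[𝕜] E) := fun x => ⟨ι 𝕜 E x, hT x⟩
  refine ⟨(T : FreeLCS 𝕜 E →ₗ[𝕜] E).ker, T.isClosed_ker, ⟨?_⟩⟩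
  refine ⟨(T : FreeLCS 𝕜 E →ₗ[𝕜] E).quotKerEquivOfSurjective hsurj, ?_, ?_⟩
  · exact T.continuous.quotient_lift _
  · have : (⇑((T : FreeLCS 𝕜 E →ₗ[𝕜] E).quotKerEquivOfSurjective hsurj).symm) =
        fun x => Submodule.Quotient.mk (ι 𝕜 E x) := by
      funext x
      rw [LinearEquiv.symm_apply_eq]
      exact (hT x).symm
    change Continuous ((T : FreeLCS 𝕜 E →ₗ[𝕜] E).quotKerEquivOfSurjective hsurj).symm
    rw [this]
    exact continuous_quotient_mk'.comp (continuous_ι 𝕜 E)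

theorem t35Space_of_isTopologicalAddGroup (E : Type w) [AddCommGroup E] [TopologicalSpace E]
    [IsTopologicalAddGroup E] [T2Space E] : T35Space E := by
  let := IsTopologicalAddGroup.rightUniformSpace E
  exact {}

/-! ### The sequence spaces `ℓ_q`, `1 < q < ∞` -/

section SequenceSpace

variable {𝕜 : Type k} [RCLike 𝕜] {p q : ℝ}

/-- Half of the duality between `ℓ_q` and `ℓ_p`: a functional on `ℓ_q` is given by a sequence in
`ℓ_p`. -/
theorem lp.sum_norm_apply_single_rpow_le (hpq : p.HolderConjugate q)
    [Fact (1 ≤ ENNReal.ofReal q)]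
    (χ : StrongDual 𝕜 (lp (fun _ : ℕ => 𝕜) (ENNReal.ofReal q))) (s : Finset ℕ) :
    ∑ i ∈ s, ‖χ (lp.single (ENNReal.ofReal q) i 1)‖ ^ p ≤ ‖χ‖ ^ p := by
  have hq : (ENNReal.ofReal q).toReal = q := ENNReal.toReal_ofReal hpq.symm.nonneg
  set a : ℕ → 𝕜 := fun i => χ (lp.single (ENNReal.ofReal q) i 1) with ha
  -- `g` is the dual sequence at which Hölder's inequality is attained
  obtain ⟨g, hg, hgs⟩ := (NNReal.isGreatest_Lp s (fun i => ‖a i‖₊) hpq).1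
  have hg' : ∑ i ∈ s, (g i : ℝ) ^ q ≤ 1 := by exact_mod_cast hg
  have hgs' : ∑ i ∈ s, ‖a i‖ * g i = (∑ i ∈ s, ‖a i‖ ^ p) ^ (1 / p) := by
    have := congrArg NNReal.toReal hgs
    simpa using this
  let c : ℕ → 𝕜 := fun i => (g i : ℝ) * ((‖a i‖ : 𝕜) / a i)
  let y := ∑ i ∈ s, lp.single (E := fun _ : ℕ => 𝕜) (ENNReal.ofReal q) i (c i)
  have hc : ∀ i, ‖c i‖ ≤ g i := fun i => by
    simp only [c, norm_mul, norm_div, RCLike.norm_ofReal, abs_norm, NNReal.abs_eq]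
    exact mul_le_of_le_one_right (g i).2 (div_self_le_one _)
  have hy : ‖y‖ ≤ 1 := by
    have h1 := lp.norm_sum_single (p := ENNReal.ofReal q) (hq.symm ▸ hpq.symm.pos) c s
    rw [hq] at h1
    have h2 : ‖y‖ ^ q ≤ 1 := h1.trans_le <| (Finset.sum_le_sum fun i _ =>
      Real.rpow_le_rpow (norm_nonneg _) (hc i) hpq.symm.nonneg).trans hg'
    rwa [← Real.one_rpow q, Real.rpow_le_rpow_iff (norm_nonneg _) zero_le_one hpq.symm.pos] at h2
  have hχy : χ y = ((∑ i ∈ s, ‖a i‖ * g i : ℝ) : 𝕜) := by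
    simp only [y, map_sum]
    push_cast
    refine Finset.sum_congr rfl fun i _ => ?_
    have h1 : lp.single (E := fun _ : ℕ => 𝕜) (ENNReal.ofReal q) i (c i) =
        c i • lp.single (E := fun _ : ℕ => 𝕜) (ENNReal.ofReal q) i 1 := by
      rw [← lp.single_smul, smul_eq_mul, mul_one]
    rw [h1, map_smul, smul_eq_mul]
    change (g i : ℝ) * ((‖a i‖ : 𝕜) / a i) * a i = _
    by_cases h : a i = 0
    · simp [h]
    · field_simp
  have h3 : (∑ i ∈ s, ‖a i‖ ^ p) ^ (1 / p) ≤ ‖χ‖ := by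
    rw [← hgs']
    calc _ ≤ ‖χ y‖ := by rw [hχy, RCLike.norm_ofReal]; exact le_abs_self _
      _ ≤ ‖χ‖ * ‖y‖ := χ.le_opNorm y
      _ ≤ ‖χ‖ := mul_le_of_le_one_right (norm_nonneg _) hy
  have hs0 : 0 ≤ ∑ i ∈ s, ‖a i‖ ^ p := by positivity
  have h4 := Real.rpow_le_rpow (by positivity) h3 hpq.nonneg
  rwa [← Real.rpow_mul hs0, one_div_mul_cancel hpq.ne_zero, Real.rpow_one] at h4

/-- The unit vectors of `ℓ_q` are weakly `p`-summable, for conjugate exponents `p` and `q`. -/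
theorem lp.memℓp_apply_single (hpq : p.HolderConjugate q) [Fact (1 ≤ ENNReal.ofReal q)]
    (χ : StrongDual 𝕜 (lp (fun _ : ℕ => 𝕜) (ENNReal.ofReal q))) :
    Memℓp (fun i => χ (lp.single (ENNReal.ofReal q) i 1)) (ENNReal.ofReal p) :=
  memℓp_gen' (C := ‖χ‖ ^ p) fun s => by
    rw [ENNReal.toReal_ofReal hpq.nonneg]
    exact sum_norm_apply_single_rpow_le hpq χ s

/-- The closed balls of `ℓ_q` are weakly compact. They are compact for coordinatewise convergence,
and by Hölder's inequality each functional is a uniform limit on them of finite linear combinations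
of coordinates. -/
theorem lp.isCompact_toWeakSpace_closedBall (hpq : p.HolderConjugate q)
    [Fact (1 ≤ ENNReal.ofReal q)] (R : ℝ) :
    IsCompact (toWeakSpace 𝕜 (lp (fun _ : ℕ => 𝕜) (ENNReal.ofReal q)) ''
      Metric.closedBall 0 R) := by
  have hq : (ENNReal.ofReal q).toReal = q := ENNReal.toReal_ofReal hpq.symm.nonneg
  have hq0 : 0 < (ENNReal.ofReal q).toReal := hq.symm ▸ hpq.symm.pos
  rcases lt_or_ge R 0 with hR | hR
  · simp [Metric.closedBall_eq_empty.2 hR]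
  let D : Set (ℕ → 𝕜) := {f | ∀ s : Finset ℕ, ∑ i ∈ s, ‖f i‖ ^ q ≤ R ^ q}
  have hDc : IsCompact D := by
    refine (isCompact_univ_pi fun _ : ℕ => isCompact_closedBall (0 : 𝕜) R).of_isClosed_subset ?_ ?_
    · simp only [D, Set.ofPred_forall]
      refine isClosed_iInter fun s => isClosed_le ?_ continuous_const
      exact continuous_finsetSum _ fun i _ =>
        (continuous_apply i).norm.rpow_const fun _ => Or.inr hpq.symm.nonneg
    · intro f hf i _
      have := hf {i}
      rw [Finset.sum_singleton] at this
      simpa using (Real.rpow_le_rpow_iff (norm_nonneg _) hR hpq.symm.pos).1 this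
  let Φ : D → lp (fun _ : ℕ => 𝕜) (ENNReal.ofReal q) := fun f =>
    ⟨f.1, memℓp_gen' (C := R ^ q) fun s => by rw [hq]; exact f.2 s⟩
  have hΦ : Continuous fun f => toWeakSpace 𝕜 _ (Φ f) := by
    refine WeakBilin.continuous_of_continuous_eval _ fun χ => ?_
    change Continuous fun f => χ (Φ f)
    set a : ℕ → 𝕜 := fun i => χ (lp.single (ENNReal.ofReal q) i 1) with ha
    have hsum : ∀ f : D, HasSum (fun i => f.1 i * a i) (χ (Φ f)) := fun f => by
      have h := (lp.hasSum_single ENNReal.ofReal_ne_top (Φ f)).mapL χ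
      refine h.congr_fun fun i => ?_
      have h1 : lp.single (E := fun _ : ℕ => 𝕜) (ENNReal.ofReal q) i (f.1 i) =
          f.1 i • lp.single (E := fun _ : ℕ => 𝕜) (ENNReal.ofReal q) i 1 := by
        rw [← lp.single_smul, smul_eq_mul, mul_one]
      exact ((congrArg χ h1).trans (map_smul χ _ _)).symm
    have hsa : Summable fun i => ‖a i‖ ^ p := summable_of_sum_le (fun i => by positivity)
      fun s => sum_norm_apply_single_rpow_le hpq χ s
    have hunif : TendstoUniformly (fun (s : Finset ℕ) (f : D) => ∑ i ∈ s, f.1 i * a i)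
        (fun f => χ (Φ f)) atTop := by
      rw [Metric.tendstoUniformly_iff]
      intro ε hε
      obtain ⟨δ, hδ, hδε⟩ : ∃ δ > 0, R * δ < ε :=
        ⟨ε / (R + 1), by positivity, by
          rw [mul_div_assoc', div_lt_iff₀ (by positivity)]; nlinarith⟩
      obtain ⟨s₀, hs₀⟩ := summable_iff_vanishing_norm.1 hsa (δ ^ p) (by positivity)
      filter_upwards [eventually_ge_atTop s₀] with s hs f
      have hlim : Tendsto (fun t : Finset ℕ => dist (∑ i ∈ t, f.1 i * a i) (∑ i ∈ s, f.1 i * a i))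
          atTop (𝓝 (dist (χ (Φ f)) (∑ i ∈ s, f.1 i * a i))) := (hsum f).dist tendsto_const_nhds
      refine lt_of_le_of_lt (le_of_tendsto hlim ?_) hδε
      filter_upwards [eventually_ge_atTop s] with t hst
      have hdisj : Disjoint (t \ s) s₀ := Finset.disjoint_of_subset_right hs Finset.sdiff_disjoint
      have h1 := hs₀ _ hdisj
      rw [Real.norm_of_nonneg (by positivity)] at h1
      rw [dist_eq_norm, ← Finset.sum_sdiff hst, add_sub_cancel_right]
      calc ‖∑ i ∈ t \ s, f.1 i * a i‖ ≤ ∑ i ∈ t \ s, ‖f.1 i‖ * ‖a i‖ :=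
            (norm_sum_le _ _).trans (Finset.sum_le_sum fun i _ => norm_mul_le _ _)
        _ ≤ (∑ i ∈ t \ s, ‖f.1 i‖ ^ q) ^ (1 / q) * (∑ i ∈ t \ s, ‖a i‖ ^ p) ^ (1 / p) :=
            Real.inner_le_Lp_mul_Lq_of_nonneg _ hpq.symm (fun _ _ => norm_nonneg _)
              fun _ _ => norm_nonneg _
        _ ≤ (R ^ q) ^ (1 / q) * (δ ^ p) ^ (1 / p) := by
            gcongr
            · exact hpq.symm.one_div_nonneg
            · exact f.2 _
            · exact hpq.one_div_nonneg
        _ = R * δ := by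
            rw [← Real.rpow_mul hR, ← Real.rpow_mul hδ.le, mul_one_div_cancel hpq.symm.ne_zero,
              mul_one_div_cancel hpq.ne_zero, Real.rpow_one, Real.rpow_one]
    refine hunif.continuous (Eventually.of_forall fun s => ?_).frequently
    exact continuous_finsetSum _ fun i _ =>
      ((continuous_apply i).comp continuous_subtype_val).mul continuous_const
  have : CompactSpace D := isCompact_iff_compactSpace.1 hDc
  convert isCompact_range hΦ using 1
  rw [Set.range_comp' (toWeakSpace 𝕜 _) Φ]
  congr 1
  ext y
  rw [mem_closedBall_zero_iff]
  constructor
  · intro hy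
    refine ⟨⟨y, fun s => ?_⟩, rfl⟩
    have h1 := lp.sum_rpow_le_norm_rpow hq0 y s
    rw [hq] at h1
    exact h1.trans (Real.rpow_le_rpow (norm_nonneg _) hy hpq.symm.nonneg)
  · rintro ⟨f, rfl⟩
    exact lp.norm_le_of_forall_sum_le hq0 hR fun s => by rw [hq]; exact f.2 s

theorem lp.mapsBoundedToRelWeaklyCompact_id (hpq : p.HolderConjugate q)
    [Fact (1 ≤ ENNReal.ofReal q)] :
    MapsBoundedToRelWeaklyCompact
      (ContinuousLinearMap.id 𝕜 (lp (fun _ : ℕ => 𝕜) (ENNReal.ofReal q))) := by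
  intro B hB
  obtain ⟨R, hR⟩ := ((NormedSpace.isVonNBounded_iff 𝕜).1 hB).subset_closedBall 0
  refine (isCompact_toWeakSpace_closedBall hpq R).closure_of_subset (Set.image_mono ?_)
  simpa using hR

theorem lp.not_tendsto_single [Fact (1 ≤ ENNReal.ofReal q)] (hq : 0 < q) :
    ¬ Tendsto (fun n => lp.single (E := fun _ : ℕ => 𝕜) (ENNReal.ofReal q) n 1) atTop (𝓝 0) := by
  intro h
  have h1 := tendsto_zero_iff_norm_tendsto_zero.1 h
  simp [lp.norm_single (E := fun _ : ℕ => 𝕜) (ENNReal.ofReal_pos.2 hq)] at h1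

theorem lp.isWeaklyNull_single (hpq : p.HolderConjugate q) [Fact (1 ≤ ENNReal.ofReal q)] :
    IsWeaklyNull 𝕜 fun n => lp.single (E := fun _ : ℕ => 𝕜) (ENNReal.ofReal q) n 1 :=
  IsWeaklyPSummable.isWeaklyNull (p := ENNReal.ofReal p) (by simpa using hpq.lt.le) fun χ =>
    ⟨fun _ => memℓp_apply_single hpq χ, fun h => absurd h ENNReal.ofReal_ne_top⟩

theorem locallyConvexSpace_of_normedSpace {L : Type v} [NormedAddCommGroup L] [NormedSpace 𝕜 L] :
    LocallyConvexSpace 𝕜 L := by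
  let : NormedSpace ℝ L := NormedSpace.restrictScalars ℝ 𝕜 L
  have : IsScalarTower ℝ 𝕜 L := IsScalarTower.of_algebraMap_smul fun r x => rfl
  exact locallyConvexSpace_iff_real.2 inferInstance

theorem absConvex_closedBall {L : Type v} [NormedAddCommGroup L] [NormedSpace 𝕜 L] (R : ℝ) :
    AbsConvex 𝕜 (Metric.closedBall (0 : L) R) := by
  let : NormedSpace ℝ L := NormedSpace.restrictScalars ℝ 𝕜 L
  have : IsScalarTower ℝ 𝕜 L := IsScalarTower.of_algebraMap_smul fun r x => rfl
  exact ⟨balanced_closedBall_zero, convex_RCLike_iff_convex_real.2 (convex_closedBall 0 R)⟩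

theorem lp.not_hasDP (hpq : p.HolderConjugate q) [Fact (1 ≤ ENNReal.ofReal q)] :
    ¬ HasDP 𝕜 (lp (fun _ : ℕ => 𝕜) (ENNReal.ofReal q)) := by
  intro h
  have hc := h _ _ (mapsBoundedToRelWeaklyCompact_id hpq) _ (absConvex_closedBall 1)
    (isCompact_toWeakSpace_closedBall hpq 1)
  refine not_tendsto_single hpq.symm.pos
    ((isWeaklyNull_single (𝕜 := 𝕜) hpq).tendsto_zero hc fun n => subset_closure ⟨_, ?_, rfl⟩)
  exact mem_closedBall_zero_iff.2
    ((lp.norm_single (ENNReal.ofReal_pos.2 hpq.symm.pos) n 1).trans norm_one).le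

theorem lp.not_hasStrictDP (hpq : p.HolderConjugate q) [Fact (1 ≤ ENNReal.ofReal q)] {r : ℝ≥0∞}
    (hr : ENNReal.ofReal p ≤ r) :
    ¬ HasStrictDP 𝕜 (lp (fun _ : ℕ => 𝕜) (ENNReal.ofReal q)) r := fun h =>
  not_tendsto_single (𝕜 := 𝕜) hpq.symm.pos <|
    h _ _ (mapsBoundedToRelWeaklyCompact_id hpq) _ fun χ =>
      ⟨fun _ => (memℓp_apply_single hpq χ).of_exponent_ge hr,
        fun _ => isWeaklyNull_single hpq χ⟩

end SequenceSpace

/-! ### Invariance under topological isomorphism -/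

section Transfer

variable {𝕜 : Type k} [RCLike 𝕜] {E F : Type u} [AddCommGroup E] [Module 𝕜 E] [TopologicalSpace E]
  [AddCommGroup F] [Module 𝕜 F] [TopologicalSpace F]

theorem MapsBoundedToRelWeaklyCompact.comp {L : Type v} [NormedAddCommGroup L] [NormedSpace 𝕜 L]
    {T : F →L[𝕜] L} (hT : MapsBoundedToRelWeaklyCompact T) (S : E →L[𝕜] F) :
    MapsBoundedToRelWeaklyCompact (T.comp S) := by
  intro B hB
  have := hT _ (hB.image S)
  rwa [Set.image_image T S] at this

theorem HasDP.of_equiv (h : HasDP 𝕜 E) (e : E ≃L[𝕜] F) : HasDP 𝕜 F := by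
  intro L _ _ _ T hT K hK hKc
  have h1 := h L (T.comp e) (hT.comp _) (e.symm '' K)
    ⟨fun a ha => by
        rintro _ ⟨_, ⟨z, hz, rfl⟩, rfl⟩
        exact ⟨a • z, hK.1 a ha ⟨z, hz, rfl⟩, map_smul e.symm a z⟩,
      hK.2.linear_image (e.symm : F →ₗ[𝕜] E)⟩ (by
      have := hKc.image (WeakSpace.map (e.symm : F →L[𝕜] E)).continuous
      rw [Set.image_image] at this ⊢
      exact this)
  rw [Set.image_image] at h1
  simpa using h1

theorem HasStrictDP.of_equiv {p : ℝ≥0∞} (h : HasStrictDP 𝕜 E p) (e : E ≃L[𝕜] F) :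
    HasStrictDP 𝕜 F p := by
  intro L _ _ _ T hT x hx
  simpa using h L (T.comp (e : E →L[𝕜] F)) (hT.comp _) (fun n => e.symm (x n)) fun χ =>
    hx (χ.comp (e.symm : F →L[𝕜] E))

end Transfer

/-! ### Failure of the sequential Dunford–Pettis property -/

section Sequential

/-- Functionals on `L(X)` given by disjointly supported functions with values in the unit disc form
a weakly null sequence in the strong dual. Indeed their linear combinations with coefficients in the
unit disc are again given by functions with values in the unit disc, hence are bounded in the strong
dual; so the values of a functional on the sequence are absolutely summable. -/
theorem FreeLCS.isWeaklyNull_integral {𝕜 : Type k} [RCLike 𝕜] {X : Type u} [TopologicalSpace X]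
    [T35Space X] (g : ℕ → C(X, 𝕜)) (hg : ∀ n x, ‖g n x‖ ≤ 1)
    (hdisj : ∀ m n x, g m x ≠ 0 → g n x ≠ 0 → m = n) :
    IsWeaklyNull 𝕜 fun n => integral (g n) := by
  intro Φ
  have hnhds : Φ ⁻¹' Metric.ball 0 1 ∈ 𝓝 (0 : StrongDual 𝕜 (FreeLCS 𝕜 X)) :=
    Φ.continuous.continuousAt.preimage_mem_nhds (by simpa using Metric.ball_mem_nhds _ one_pos)
  obtain ⟨⟨B, V⟩, ⟨hB, hV⟩, hBV⟩ := ContinuousLinearMap.hasBasis_nhds_zero.mem_iff.1 hnhds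
  obtain ⟨ε, hε, hεV⟩ := Metric.mem_nhds_iff.1 hV
  obtain ⟨C, hC⟩ := exists_weighted_variation_le hB.isWeaklyBounded (1 : C(X, ℝ))
  set δ : ℝ := ε / (|C| + 1) with hδ
  have hδ0 : 0 < δ := by positivity
  have hcomb : ∀ (s : Finset ℕ) (c : ℕ → 𝕜), (∀ n, ‖c n‖ ≤ 1) →
      ‖∑ n ∈ s, c n * Φ (integral (g n))‖ ≤ δ⁻¹ := by
    intro s c hc
    have hpt : ∀ x, ‖∑ n ∈ s, c n * g n x‖ ≤ 1 := by
      intro x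
      by_cases h : ∃ n ∈ s, g n x ≠ 0
      · obtain ⟨n, hn, hnx⟩ := h
        rw [Finset.sum_eq_single n (fun m _ hmn => ?_) fun h => absurd hn h, norm_mul]
        · exact mul_le_one₀ (hc n) (norm_nonneg _) (hg n x)
        · by_contra h0
          exact hmn (hdisj m n x (right_ne_zero_of_mul h0) hnx)
      · push Not at h
        rw [Finset.sum_eq_zero fun n hn => by rw [h n hn, mul_zero]]
        simp
    have hmem : (δ : 𝕜) • ∑ n ∈ s, c n • integral (g n) ∈ Φ ⁻¹' Metric.ball 0 1 := by
      refine hBV fun z hz => hεV ?_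
      have h1 : (∑ n ∈ s, c n • integral (g n)) z =
          ∑ x ∈ (coeff 𝕜 X z).support, coeff 𝕜 X z x * ∑ n ∈ s, c n * g n x := by
        rw [_root_.sum_apply]
        simp only [_root_.smul_apply, integral_apply, Finset.mul_sum,
          smul_eq_mul]
        rw [Finset.sum_comm]
        exact Finset.sum_congr rfl fun x _ => Finset.sum_congr rfl fun n _ => by ring
      have h2 : ‖(∑ n ∈ s, c n • integral (g n)) z‖ ≤ C := by
        rw [h1]
        refine (norm_sum_le _ _).trans (le_trans (Finset.sum_le_sum fun x _ => ?_) (hC z hz))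
        rw [norm_mul]
        exact mul_le_mul_of_nonneg_left (hpt x) (norm_nonneg _)
      rw [mem_ball_zero_iff, _root_.smul_apply, norm_smul, RCLike.norm_ofReal,
        abs_of_pos hδ0]
      calc δ * _ ≤ δ * |C| := by gcongr; exact h2.trans (le_abs_self C)
        _ < δ * (|C| + 1) := by gcongr; linarith
        _ = ε := by rw [hδ]; field_simp
    rw [Set.mem_preimage, mem_ball_zero_iff, map_smul, norm_smul, RCLike.norm_ofReal,
      abs_of_pos hδ0, map_sum] at hmem
    simp only [map_smul, smul_eq_mul] at hmem
    rw [← one_div, le_div_iff₀' hδ0]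
    exact hmem.le
  have hsum : Summable fun n => ‖Φ (integral (g n))‖ := by
    refine summable_of_sum_le (c := δ⁻¹) (fun n => norm_nonneg _) fun s => ?_
    have h := hcomb s (fun n => (‖Φ (integral (g n))‖ : 𝕜) / Φ (integral (g n))) fun n => by
      rw [norm_div, RCLike.norm_ofReal, abs_norm]
      exact div_self_le_one _
    have h1 : ∑ n ∈ s, (‖Φ (integral (g n))‖ : 𝕜) / Φ (integral (g n)) * Φ (integral (g n)) =
        ((∑ n ∈ s, ‖Φ (integral (g n))‖ : ℝ) : 𝕜) := by
      push_cast
      refine Finset.sum_congr rfl fun n _ => ?_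
      by_cases h0 : Φ (integral (g n)) = 0
      · simp [h0]
      · field_simp
    rw [h1, RCLike.norm_ofReal] at h
    exact (le_abs_self _).trans h
  exact tendsto_zero_iff_norm_tendsto_zero.2 hsum.tendsto_atTop_zero

/-- A point that is not isolated is the limit of a sequence approaching it geometrically fast. -/
theorem exists_seq_tendsto_dist_lt {X : Type u} [MetricSpace X] {a : X}
    (ha : ¬ IsOpen ({a} : Set X)) :
    ∃ x : ℕ → X, Tendsto x atTop (𝓝 a) ∧ (∀ n, 0 < dist (x n) a) ∧
      ∀ m n, m < n → dist (x n) a < dist (x m) a / 4 := by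
  have : (𝓝[≠] a).NeBot := ⟨fun h => ha ((isOpen_singleton_iff_punctured_nhds a).2 h)⟩
  obtain ⟨x, hx, hlt⟩ := exists_seq_of_forall_finset_exists (fun y => 0 < dist y a)
    (fun y z => dist z a < dist y a / 4) fun s hs => by
      have h1 : ∀ᶠ z in 𝓝[≠] a, ∀ y ∈ s, dist z a < dist y a / 4 :=
        (Filter.eventually_all_finset s).2 fun y hy => nhdsWithin_le_nhds <|
          Metric.eventually_nhds_iff.2 ⟨dist y a / 4, by linarith [hs y hy], fun _ h => h⟩
      obtain ⟨z, hz, hza⟩ := (h1.and eventually_mem_nhdsWithin).exists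
      exact ⟨z, dist_pos.2 hza, hz⟩
  refine ⟨x, ?_, hx, hlt⟩
  have hle : ∀ n, dist (x n) a ≤ dist (x 0) a * (1 / 4) ^ n := by
    intro n
    induction n with
    | zero => simp
    | succ n ih =>
      have := hlt n (n + 1) n.lt_succ_self
      rw [pow_succ]
      linarith
  rw [tendsto_iff_dist_tendsto_zero]
  refine squeeze_zero (fun n => dist_nonneg) hle ?_
  simpa using (tendsto_pow_atTop_nhds_zero_of_lt_one (r := (1 / 4 : ℝ)) (by norm_num)
    (by norm_num)).const_mul (dist (x 0) a)

/-- If `x n → a`, then the differences `x n - a` are weakly null in `L(X)`, while disjointly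
supported bumps at the points `x n` take the value `1` on them and are weakly null in the strong
dual. -/
theorem FreeLCS.not_hasSequentialDP (𝕜 : Type k) [RCLike 𝕜] (X : Type u) [TopologicalSpace X]
    [TopologicalSpace.MetrizableSpace X] (hX : ¬ DiscreteTopology X) :
    ¬ HasSequentialDP 𝕜 (FreeLCS 𝕜 X) := by
  intro h
  let : MetricSpace X := TopologicalSpace.metrizableSpaceMetric X
  obtain ⟨a, ha⟩ : ∃ a : X, ¬ IsOpen ({a} : Set X) := by
    by_contra! h0
    exact hX (discreteTopology_iff_isOpen_singleton.2 h0)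
  obtain ⟨x, hx, hpos, hlt⟩ := exists_seq_tendsto_dist_lt ha
  let φ : ℕ → X → ℝ := fun n y => max 0 (1 - 2 * |dist y a - dist (x n) a| / dist (x n) a)
  let g : ℕ → C(X, 𝕜) := fun n => ⟨fun y => (φ n y : 𝕜), by fun_prop⟩
  have hφ : ∀ n y, φ n y ≠ 0 → dist (x n) a / 2 < dist y a ∧ dist y a < 3 / 2 * dist (x n) a := by
    intro n y hy
    have h1 : 0 < 1 - 2 * |dist y a - dist (x n) a| / dist (x n) a := by
      by_contra h0
      exact hy (max_eq_left (not_lt.1 h0))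
    rw [sub_pos, div_lt_one (hpos n)] at h1
    have h2 : |dist y a - dist (x n) a| < dist (x n) a / 2 := by linarith
    rw [abs_lt] at h2
    constructor <;> linarith [h2.1, h2.2]
  have hnull : IsWeaklyNull 𝕜 fun n => integral (g n) := by
    refine isWeaklyNull_integral g (fun n y => ?_) fun m n y hm hn => ?_
    · have h0 : 0 ≤ φ n y := le_max_left _ _
      have h1 : φ n y ≤ 1 := by
        have := hpos n
        exact max_le zero_le_one (sub_le_self _ (by positivity))
      simpa [g, abs_of_nonneg h0] using h1
    · have hm' := hφ m y fun h0 => hm (by simp [g, h0])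
      have hn' := hφ n y fun h0 => hn (by simp [g, h0])
      rcases lt_trichotomy m n with hmn | hmn | hmn
      · linarith [hlt m n hmn, hm'.1, hn'.2, hpos m]
      · exact hmn
      · linarith [hlt n m hmn, hn'.1, hm'.2, hpos n]
  have hdiff : IsWeaklyNull 𝕜 fun n => ι 𝕜 X (x n) - ι 𝕜 X a := by
    intro χ
    have h1 := ((χ.continuous.comp (continuous_ι 𝕜 X)).tendsto a).comp hx
    simpa using h1.sub_const (χ (ι 𝕜 X a))
  have hval : ∀ n, integral (g n) (ι 𝕜 X (x n) - ι 𝕜 X a) = 1 := by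
    intro n
    have h1 : φ n (x n) = 1 := by simp [φ]
    have h2 : φ n a = 0 := by
      have := hpos n
      simp only [φ, dist_self, zero_sub, abs_neg, abs_of_pos this]
      rw [mul_div_cancel_right₀ _ this.ne']
      norm_num
    rw [map_sub, integral_ι, integral_ι]
    simp [g, h1, h2]
  have hlim := h _ _ hdiff hnull
  simp only [hval] at hlim
  exact one_ne_zero (tendsto_nhds_unique tendsto_const_nhds hlim)

end Sequential

/-! ### Dunford–Pettis properties of free locally convex spaces and their quotients -/

theorem proposition4p13 (𝕜 : Type k) [RCLike 𝕜] (p : ℝ≥0∞) (hp : 1 ≤ p) :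
    -- `L(X)` has both properties
    (∀ (X : Type u) [TopologicalSpace X] [T35Space X],
      HasDP 𝕜 (FreeLCS 𝕜 X) ∧ HasStrictDP 𝕜 (FreeLCS 𝕜 X) p) ∧
    -- every locally convex space is a quotient of a space with both properties
    (∀ (E : Type w) [AddCommGroup E] [Module 𝕜 E] [TopologicalSpace E] [IsTopologicalAddGroup E]
      [ContinuousSMul 𝕜 E] [LocallyConvexSpace 𝕜 E] [T2Space E],
      ∃ (F : Type (max w k)) (_ : AddCommGroup F) (_ : Module 𝕜 F) (_ : TopologicalSpace F)
        (_ : IsTopologicalAddGroup F) (_ : ContinuousSMul 𝕜 F) (_ : LocallyConvexSpace 𝕜 F)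
        (_ : T2Space F) (N : Submodule 𝕜 F),
        HasDP 𝕜 F ∧ HasStrictDP 𝕜 F p ∧ IsClosed (N : Set F) ∧ Nonempty ((F ⧸ N) ≃L[𝕜] E)) ∧
    -- quotients need not inherit them
    (∃ (F : Type k) (_ : AddCommGroup F) (_ : Module 𝕜 F) (_ : TopologicalSpace F)
      (_ : IsTopologicalAddGroup F) (_ : ContinuousSMul 𝕜 F) (_ : LocallyConvexSpace 𝕜 F)
      (_ : T2Space F) (N : Submodule 𝕜 F),
      HasDP 𝕜 F ∧ HasStrictDP 𝕜 F p ∧ IsClosed (N : Set F) ∧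
        ¬ HasDP 𝕜 (F ⧸ N) ∧ (1 < p → ¬ HasStrictDP 𝕜 (F ⧸ N) p)) ∧
    -- failure of the sequential property
    (∀ (X : Type u) [TopologicalSpace X] [TopologicalSpace.MetrizableSpace X],
      ¬ DiscreteTopology X → ¬ HasSequentialDP 𝕜 (FreeLCS 𝕜 X)) := by
  refine ⟨fun X _ _ => ⟨FreeLCS.hasDP, FreeLCS.hasStrictDP hp⟩, ?_, ?_,
    fun X _ _ hX => FreeLCS.not_hasSequentialDP 𝕜 X hX⟩
  · intro E _ _ _ _ _ _ _
    have := t35Space_of_isTopologicalAddGroup E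
    obtain ⟨N, hN, he⟩ := FreeLCS.exists_quotient_equiv 𝕜 E
    exact ⟨FreeLCS 𝕜 E, _, _, _, inferInstance, inferInstance, inferInstance, inferInstance, N,
      FreeLCS.hasDP, FreeLCS.hasStrictDP hp, hN, he⟩
  · -- The quotient is `ℓ_q`; for `p = 1` or `p = ∞` the choice `q = 2` will do.
    obtain ⟨r, hr1, hrp⟩ : ∃ r : ℝ, 1 < r ∧ (1 < p → ENNReal.ofReal r ≤ p) := by
      by_cases h : 1 < p ∧ p ≠ ∞
      · exact ⟨p.toReal, by simpa using (ENNReal.toReal_lt_toReal ENNReal.one_ne_top h.2).2 h.1,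
          fun _ => ENNReal.ofReal_toReal_le⟩
      · refine ⟨2, one_lt_two, fun h1 => ?_⟩
        rw [not_ne_iff.1 fun h2 => h ⟨h1, h2⟩]
        exact le_top
    have hrq : r.HolderConjugate r.conjExponent := .conjExponent hr1
    have : Fact (1 ≤ ENNReal.ofReal r.conjExponent) := ⟨by simpa using hrq.symm.lt.le⟩
    let E := lp (fun _ : ℕ => 𝕜) (ENNReal.ofReal r.conjExponent)
    have : LocallyConvexSpace 𝕜 E := locallyConvexSpace_of_normedSpace
    obtain ⟨N, hN, ⟨e⟩⟩ := FreeLCS.exists_quotient_equiv 𝕜 E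
    exact ⟨FreeLCS 𝕜 E, _, _, _, inferInstance, inferInstance, inferInstance, inferInstance, N,
      FreeLCS.hasDP, FreeLCS.hasStrictDP hp, hN, fun h => lp.not_hasDP hrq (h.of_equiv e),
      fun h1 h => lp.not_hasStrictDP hrq (hrp h1) (h.of_equiv e)⟩
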